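/- Fix a field $\mathbb{F}$. An \emph{interval} of a poset $P$ is a nonempty subset $I\subseteq P$ that is convex ($p\le r\le q$ with $p,q\in I$ implies $r\in I$) and connected (any two points of $I$ are joined by a finite sequence of points of $I$ whose consecutive members are comparable); $\mathbf{Int}(P)$ denotes the set of finite intervals of $P$. A $P$-module is a functor from $P$ to finite-dimensional $\mathbb{F}$-vector spaces. The interval module $\mathbb{I}_I$ is $\mathbb{F}$ at the points of $I$ and $0$ elsewhere, with identity maps between the points of $I$ and zero maps otherwise. A $P$-module $M$ is \emph{interval decomposable} if $M\cong\bigoplus_{j\in\mathcal{J}}\mathbb{I}_{I_j}$ for some family of intervals; the multiset $\{I_j : j\in\mathcal{J}\}$ is then the \emph{barcode} $\mathrm{barc}(M)$. For $I\in\mathbf{Int}(P)$, the \emph{generalized rank} $\mathrm{rk}(M)(I)$ is the rank of the canonical map $\varprojlim M|_I\to M_p\to\varinjlim M|_I$ (for any $p\in I$). Let $P\in\mathbf{Int}(\mathbb{Z}^2)$ (with the product order on $\mathbb{Z}^2$), let $K$ be a finite abstract simplicial complex, let $\mathcal{F}$ be an order-preserving map from $P$ to the poset of subcomplexes of $K$,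 and let $M_{\mathcal{F}}:p\mapsto H_n(\mathcal{F}(p);\mathbb{F})$ be the $P$-module induced by simplicial homology in some degree $n\ge 0$. \textbf{Proposition.} Suppose that $M_{\mathcal{F}}$ is interval decomposable, and let $I\in\mathbf{Int}(P)$ with $\mathrm{rk}(M_{\mathcal{F}})(I)>0$ be maximal, i.e. $\mathrm{rk}(M_{\mathcal{F}})(J)=0$ for every $J\in\mathbf{Int}(P)$ with $J\supsetneq I$. Then: (1) $I$ belongs to $\mathrm{barc}(M_{\mathcal{F}})$, and its multiplicity in $\mathrm{barc}(M_{\mathcal{F}})$ equals $\mathrm{rk}(M_{\mathcal{F}})(I)$. This holds for every decomposition of $M_{\mathcal{F}}$ into interval modules. (2) With $\mu_I:=\mathrm{rk}(M_{\mathcal{F}})(I)$, the module $M_{\mathcal{F}}$ has a summand (a submodule $N$ that admits a complementary submodule) that is isomorphic to the direct sum $\mathbb{I}_I^{\mu_I}$ of $\mu_I$ copies of $\mathbb{I}_I$. -/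

import Mathlib

open CategoryTheory CategoryTheory.Limits

universe u v w

noncomputable section

namespace PersMod

/-! ### Intervals of a poset -/

/-- An interval of a poset `P`: a nonempty, convex, connected subset. -/
@[ext]
structure PosetInterval (P : Type*) [PartialOrder P] where
  carrier : Set P
  nonempty : carrier.Nonempty
  convex : ∀ ⦃p q r : P⦄, p ∈ carrier → q ∈ carrier → p ≤ r → r ≤ q → r ∈ carrier
  connected : ∀ p q : carrier,
    Relation.ReflTransGen (fun a b : carrier => a ≤ b ∨ b ≤ a) p q

/-- `Int(P)`: the set of all finite intervals of `P`. -/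
def finiteIntervals (P : Type*) [PartialOrder P] : Set (PosetInterval P) :=
  {I | I.carrier.Finite}

/-! ### Persistence modules

A `P`-module is a functor `M : P ⥤ ModuleCat 𝔽`, the poset `P` being regarded as a category.
-/

section Modules

variable {𝔽 : Type u} [Field 𝔽] {P : Type} [PartialOrder P]

open scoped Classical in
/-- The space of the interval module of `I` at `p`: all of `𝔽` if `p ∈ I`, and `0` otherwise. -/
def intervalSpace (𝔽 : Type u) [Field 𝔽] (I : PosetInterval P) (p : P) : Submodule 𝔽 𝔽 :=
  if p ∈ I.carrier then ⊤ else ⊥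

open scoped Classical in
/-- The structure map of the interval module of `I` from `p` to `q`: the identity of `𝔽` if
`p, q ∈ I`, and `0` otherwise. -/
def intervalMap (𝔽 : Type u) [Field 𝔽] (I : PosetInterval P) (p q : P) :
    intervalSpace 𝔽 I p →ₗ[𝔽] intervalSpace 𝔽 I q :=
  if h : p ∈ I.carrier ∧ q ∈ I.carrier then
    Submodule.inclusion (le_of_eq (by simp [intervalSpace, h.1, h.2]))
  else 0

theorem intervalMap_apply_of_mem (I : PosetInterval P) {p q : P} (hp : p ∈ I.carrier)
    (hq : q ∈ I.carrier) (x : intervalSpace 𝔽 I p) :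
    (intervalMap 𝔽 I p q x : 𝔽) = x := by
  simp [intervalMap, hp, hq]

theorem intervalMap_of_not_mem (I : PosetInterval P) {p q : P}
    (h : ¬ (p ∈ I.carrier ∧ q ∈ I.carrier)) : intervalMap 𝔽 I p q = 0 := by
  rw [intervalMap, dif_neg h]

theorem intervalSpace_eq_zero (I : PosetInterval P) {p : P} (hp : p ∉ I.carrier)
    (x : intervalSpace 𝔽 I p) : x = 0 := by
  obtain ⟨x, hx⟩ := x
  rw [intervalSpace, if_neg hp, Submodule.mem_bot] at hx
  exact Subtype.ext hx

/-- The interval module `𝕀_I`. -/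
def intervalModule (𝔽 : Type u) [Field 𝔽] (I : PosetInterval P) : P ⥤ ModuleCat.{u} 𝔽 where
  obj p := ModuleCat.of 𝔽 (intervalSpace 𝔽 I p)
  map {p q} _ := ModuleCat.ofHom (intervalMap 𝔽 I p q)
  map_id p := by
    refine ModuleCat.hom_ext (LinearMap.ext fun x => ?_)
    by_cases hp : p ∈ I.carrier
    · exact Subtype.ext (intervalMap_apply_of_mem I hp hp x)
    · exact (intervalSpace_eq_zero I hp _).trans (intervalSpace_eq_zero I hp _).symm
  map_comp {p q r} f g := by
    refine ModuleCat.hom_ext (LinearMap.ext fun x => ?_)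
    change intervalMap 𝔽 I p r x = intervalMap 𝔽 I q r (intervalMap 𝔽 I p q x)
    by_cases hp : p ∈ I.carrier
    · by_cases hr : r ∈ I.carrier
      · have hq : q ∈ I.carrier := I.convex hp hr (leOfHom f) (leOfHom g)
        apply Subtype.ext
        rw [intervalMap_apply_of_mem I hp hr, intervalMap_apply_of_mem I hq hr,
          intervalMap_apply_of_mem I hp hq]
      · exact (intervalSpace_eq_zero I hr _).trans (intervalSpace_eq_zero I hr _).symm
    · rw [intervalSpace_eq_zero I hp x]; simp

/-- The pointwise direct sum of a family of `P`-modules. -/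
def directSum {J : Type w} (N : J → P ⥤ ModuleCat.{v} 𝔽) : P ⥤ ModuleCat.{max w v} 𝔽 where
  obj p := ModuleCat.of 𝔽 (Π₀ j, (N j).obj p)
  map f := ModuleCat.ofHom (DFinsupp.mapRange.linearMap fun j => ((N j).map f).hom)
  map_id p := by
    refine ModuleCat.hom_ext (LinearMap.ext fun x => ?_)
    refine DFinsupp.ext fun j => ?_
    simp
  map_comp f g := by
    refine ModuleCat.hom_ext (LinearMap.ext fun x => ?_)
    refine DFinsupp.ext fun j => ?_
    simp

/-- The family `I : J → PosetInterval P`, regarded as a multiset of intervals, is the barcode of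
`M`: `M` is isomorphic to the direct sum of the interval modules of the `I j`. -/
def IsBarcode (M : P ⥤ ModuleCat.{u} 𝔽) {J : Type u} (I : J → PosetInterval P) : Prop :=
  Nonempty (M ≅ directSum fun j => intervalModule 𝔽 (I j))

/-- `M` is interval decomposable. -/
def IntervalDecomposable (M : P ⥤ ModuleCat.{u} 𝔽) : Prop :=
  ∃ (J : Type u) (I : J → PosetInterval P), IsBarcode M I

/-- The multiplicity of `I₀` in the multiset of intervals given by the family `I`. -/
def multiplicity {J : Type u} (I : J → PosetInterval P) (I₀ : PosetInterval P) : ℕ∞ :=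
  {j | I j = I₀}.encard

/-! ### Submodules and summands -/

/-- A submodule of a `P`-module. -/
structure Sub (M : P ⥤ ModuleCat.{u} 𝔽) where
  space : ∀ p, Submodule 𝔽 (M.obj p)
  map_mem : ∀ {p q : P} (f : p ⟶ q) (x : M.obj p), x ∈ space p → (M.map f).hom x ∈ space q

/-- A submodule as a `P`-module, with the restricted structure maps. -/
def Sub.toModule {M : P ⥤ ModuleCat.{u} 𝔽} (N : Sub M) : P ⥤ ModuleCat.{u} 𝔽 where
  obj p := ModuleCat.of 𝔽 (N.space p)
  map f := ModuleCat.ofHom ((M.map f).hom.restrict fun x hx => N.map_mem f x hx)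
  map_id p := by
    refine ModuleCat.hom_ext (LinearMap.ext fun x => Subtype.ext ?_)
    simp [LinearMap.restrict_apply]
  map_comp f g := by
    refine ModuleCat.hom_ext (LinearMap.ext fun x => Subtype.ext ?_)
    simp [LinearMap.restrict_apply]

/-- A submodule is a summand if it has a complementary submodule. -/
def Sub.IsSummand {M : P ⥤ ModuleCat.{u} 𝔽} (N : Sub M) : Prop :=
  ∃ N' : Sub M, ∀ p, IsCompl (N.space p) (N'.space p)

/-! ### The generalized rank -/

/-- The restriction of a `P`-module to an interval. -/
def restrict (M : P ⥤ ModuleCat.{u} 𝔽) (I : PosetInterval P) : I.carrier ⥤ ModuleCat.{u} 𝔽 :=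
  (Subtype.mono_coe (· ∈ I.carrier)).functor ⋙ M

/-- The composite `i_p ∘ π_p` from the limit to the colimit of `M|_I`, through the point `p`. -/
def limitToColimitAt (M : P ⥤ ModuleCat.{u} 𝔽) (I : PosetInterval P) (p : I.carrier) :
    limit (restrict M I) ⟶ colimit (restrict M I) :=
  limit.π (restrict M I) p ≫ colimit.ι (restrict M I) p

theorem limitToColimitAt_eq (M : P ⥤ ModuleCat.{u} 𝔽) (I : PosetInterval P) (p q : I.carrier) :
    limitToColimitAt M I p = limitToColimitAt M I q := by
  have key : ∀ a b : I.carrier, a ≤ b → limitToColimitAt M I a = limitToColimitAt M I b := by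
    intro a b hab
    unfold limitToColimitAt
    rw [← limit.w (restrict M I) (homOfLE hab), Category.assoc, colimit.w]
  induction I.connected p q with
  | refl => rfl
  | tail _ h ih => exact ih.trans (h.elim (key _ _) fun h => (key _ _ h).symm)

/-- The canonical limit-to-colimit map of `M|_I`: the composite `i_p ∘ π_p` for any `p ∈ I`
(by `limitToColimitAt_eq` it does not depend on `p`). -/
def limitToColimit (M : P ⥤ ModuleCat.{u} 𝔽) (I : PosetInterval P) :
    limit (restrict M I) ⟶ colimit (restrict M I) :=
  limitToColimitAt M I ⟨I.nonempty.some, I.nonempty.some_mem⟩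

/-- The generalized rank `rk(M)(I)`: the rank of the canonical limit-to-colimit map of `M|_I`. -/
def rk (M : P ⥤ ModuleCat.{u} 𝔽) (I : PosetInterval P) : ℕ :=
  Module.finrank 𝔽 (LinearMap.range (limitToColimit M I).hom)

/-- `𝓘(M)`: the set of finite intervals of positive generalized rank. -/
def positiveRankIntervals (M : P ⥤ ModuleCat.{u} 𝔽) : Set (PosetInterval P) :=
  {I | I ∈ finiteIntervals P ∧ 0 < rk M I}

/-- `I ∈ 𝓘(M)` is maximal: no finite interval strictly containing `I` has nonzero rank. -/
def IsMaximalInterval (M : P ⥤ ModuleCat.{u} 𝔽) (I : PosetInterval P) : Prop :=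
  I ∈ positiveRankIntervals M ∧
    ¬ ∃ J ∈ finiteIntervals P, I.carrier ⊂ J.carrier ∧ rk M J ≠ 0

end Modules

/-! ### Simplicial homology

Oriented simplicial chains with respect to a fixed total order of the vertices. A finite simplicial
complex (possibly empty) is a `PreAbstractSimplicialComplex` with finitely many faces, and a
subcomplex of `K` is an element of `Set.Iic K`. The chain groups of all the complexes on the vertex
type `V` are realized inside the spaces of formal combinations of vertex tuples.
-/

section Homology

variable (𝔽 : Type u) [Field 𝔽] {V : Type u}

section Tuples

variable (V) in
/-- Formal `𝔽`-linear combinations of `(n + 1)`-tuples of vertices. -/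
def TupleChain (n : ℕ) : Type u := (Fin (n + 1) → V) →₀ 𝔽

instance (n : ℕ) : AddCommGroup (TupleChain 𝔽 V n) :=
  inferInstanceAs (AddCommGroup ((Fin (n + 1) → V) →₀ 𝔽))

instance (n : ℕ) : Module 𝔽 (TupleChain 𝔽 V n) :=
  inferInstanceAs (Module 𝔽 ((Fin (n + 1) → V) →₀ 𝔽))

/-- A tuple of vertices as a basis element. -/
def single {n : ℕ} (s : Fin (n + 1) → V) : TupleChain 𝔽 V n :=
  (Finsupp.single s 1 : (Fin (n + 1) → V) →₀ 𝔽)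

variable (V) in
/-- The boundary operator,
`∂ [v_0, …, v_{n+1}] = ∑ i, (-1)^i [v_0, …, v_{i-1}, v_{i+1}, …, v_{n+1}]`. -/
def boundary (n : ℕ) : TupleChain 𝔽 V (n + 1) →ₗ[𝔽] TupleChain 𝔽 V n :=
  Finsupp.linearCombination 𝔽 fun s : Fin (n + 2) → V =>
    ∑ i : Fin (n + 2), (-1 : ℤ) ^ (i : ℕ) • single 𝔽 (s ∘ i.succAbove)

theorem boundary_single (n : ℕ) (s : Fin (n + 2) → V) :
    boundary 𝔽 V n (single 𝔽 s) =
      ∑ i : Fin (n + 2), (-1 : ℤ) ^ (i : ℕ) • single 𝔽 (s ∘ i.succAbove) :=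
  (Finsupp.linearCombination_single 𝔽 (1 : 𝔽) s).trans (one_smul 𝔽 _)

theorem hom_ext {n : ℕ} {W : Type*} [AddCommGroup W] [Module 𝔽 W]
    {f g : TupleChain 𝔽 V n →ₗ[𝔽] W} (h : ∀ s, f (single 𝔽 s) = g (single 𝔽 s)) : f = g :=
  Finsupp.lhom_ext' fun s => LinearMap.ext_ring (h s)

theorem boundary_boundary (n : ℕ) (x : TupleChain 𝔽 V (n + 2)) :
    boundary 𝔽 V n (boundary 𝔽 V (n + 1) x) = 0 := by
  suffices h : (boundary 𝔽 V n).comp (boundary 𝔽 V (n + 1)) = 0 from LinearMap.congr_fun h x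
  refine hom_ext 𝔽 fun s => ?_
  simp only [LinearMap.comp_apply, LinearMap.zero_apply,
    boundary_single, map_sum, map_zsmul, Finset.smul_sum, smul_smul, Function.comp_assoc]
  rw [← Finset.sum_product']
  refine Finset.sum_involution
    (fun ij _ => (ij.1.succAbove ij.2, ij.2.predAbove ij.1)) ?_ ?_ ?_ ?_
  · rintro ⟨i, j⟩ -
    have h : i.succAbove ∘ j.succAbove
        = (i.succAbove j).succAbove ∘ (j.predAbove i).succAbove := by
      funext k
      exact (Fin.succAbove_succAbove_succAbove_predAbove i j k).symm
    simp only [h, ← add_smul]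
    have : (-1 : ℤ) ^ (i : ℕ) * (-1) ^ (j : ℕ)
        + (-1) ^ ((i.succAbove j : Fin _) : ℕ) * (-1) ^ ((j.predAbove i : Fin _) : ℕ) = 0 := by
      rcases lt_or_ge j.castSucc i with hij | hij
      · rw [Fin.succAbove_of_castSucc_lt _ _ hij, Fin.predAbove_of_castSucc_lt _ _ hij]
        obtain ⟨i', rfl⟩ := Fin.exists_succ_eq.2 (Fin.ne_zero_of_lt hij)
        simp [pow_succ]; ring
      · rw [Fin.succAbove_of_le_castSucc _ _ hij, Fin.predAbove_of_le_castSucc _ _ hij]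
        simp [pow_succ]; ring
    rw [this, zero_smul]
  · rintro ⟨i, j⟩ - - h
    exact Fin.succAbove_ne i j (congrArg Prod.fst h)
  · intros; exact Finset.mem_univ _
  · rintro ⟨i, j⟩ -
    simp [Fin.succAbove_succAbove_predAbove, Fin.predAbove_predAbove_succAbove]

end Tuples

variable [LinearOrder V]

/-- The `n`-simplices of `K`, as strictly increasing tuples of vertices. -/
def simplices (K : PreAbstractSimplicialComplex V) (n : ℕ) : Set (Fin (n + 1) → V) :=
  {s | StrictMono s ∧ Finset.univ.image s ∈ K.faces}

/-- The space `C_n(K)` of simplicial `n`-chains. -/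
def chains (K : PreAbstractSimplicialComplex V) (n : ℕ) :
    Submodule 𝔽 (TupleChain 𝔽 V n) :=
  Submodule.span 𝔽 (single 𝔽 '' simplices K n)

/-- The space `Z_n(K)` of simplicial `n`-cycles; every `0`-chain is a cycle. -/
def cycles (K : PreAbstractSimplicialComplex V) : ∀ n : ℕ, Submodule 𝔽 (TupleChain 𝔽 V n)
  | 0 => chains 𝔽 K 0
  | n + 1 => chains 𝔽 K (n + 1) ⊓ LinearMap.ker (boundary 𝔽 V n)

/-- The space `B_n(K)` of simplicial `n`-boundaries. -/
def boundaries (K : PreAbstractSimplicialComplex V) (n : ℕ) :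
    Submodule 𝔽 (TupleChain 𝔽 V n) :=
  (chains 𝔽 K (n + 1)).map (boundary 𝔽 V n)

theorem chains_mono {K L : PreAbstractSimplicialComplex V} (h : K ≤ L) (n : ℕ) :
    chains 𝔽 K n ≤ chains 𝔽 L n :=
  Submodule.span_mono (Set.image_mono fun _ hs => ⟨hs.1, h hs.2⟩)

theorem boundary_mem_chains (K : PreAbstractSimplicialComplex V) (n : ℕ) :
    (chains 𝔽 K (n + 1)).map (boundary 𝔽 V n) ≤ chains 𝔽 K n := by
  rw [chains, Submodule.map_span, Submodule.span_le]
  rintro _ ⟨_, ⟨s, hs, rfl⟩, rfl⟩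
  rw [boundary_single]
  refine Submodule.sum_mem _ fun i _ => zsmul_mem
    (Submodule.subset_span (Set.mem_image_of_mem _ ?_)) _
  refine ⟨hs.1.comp (Fin.strictMono_succAbove i), (K.isRelLowerSet_faces hs.2).2 ?_ ?_⟩
  · intro a ha
    simp only [Finset.mem_image, Finset.mem_univ, true_and, Function.comp_apply] at ha ⊢
    obtain ⟨k, rfl⟩ := ha
    exact ⟨_, rfl⟩
  · exact Finset.univ_nonempty.image _

theorem boundaries_le_cycles (K : PreAbstractSimplicialComplex V) (n : ℕ) :
    boundaries 𝔽 K n ≤ cycles 𝔽 K n := by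
  cases n with
  | zero => exact boundary_mem_chains 𝔽 K 0
  | succ n =>
    refine le_inf (boundary_mem_chains 𝔽 K (n + 1)) ?_
    rintro _ ⟨x, -, rfl⟩
    exact boundary_boundary 𝔽 n x

theorem cycles_mono {K L : PreAbstractSimplicialComplex V} (h : K ≤ L) (n : ℕ) :
    cycles 𝔽 K n ≤ cycles 𝔽 L n := by
  cases n with
  | zero => exact chains_mono 𝔽 h 0
  | succ n => exact inf_le_inf_right _ (chains_mono 𝔽 h _)

theorem boundaries_mono {K L : PreAbstractSimplicialComplex V} (h : K ≤ L) (n : ℕ) :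
    boundaries 𝔽 K n ≤ boundaries 𝔽 L n :=
  Submodule.map_mono (chains_mono 𝔽 h _)

/-- The simplicial homology `H_n(K; 𝔽) = Z_n(K) / B_n(K)`. -/
abbrev Homology (K : PreAbstractSimplicialComplex V) (n : ℕ) : Type u :=
  cycles 𝔽 K n ⧸ (boundaries 𝔽 K n).submoduleOf (cycles 𝔽 K n)

/-- The map in homology induced by an inclusion of complexes. -/
def homologyMap {K L : PreAbstractSimplicialComplex V} (h : K ≤ L) (n : ℕ) :
    Homology 𝔽 K n →ₗ[𝔽] Homology 𝔽 L n :=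
  Submodule.mapQ _ _ (Submodule.inclusion (cycles_mono 𝔽 h n))
    fun _ hx => boundaries_mono 𝔽 h n hx

theorem finite_simplices {K : PreAbstractSimplicialComplex V} (hK : K.faces.Finite) (n : ℕ) :
    (simplices K n).Finite := by
  refine Set.Finite.of_finite_image (f := fun s => Finset.univ.image s)
    (hK.subset ?_) ?_
  · rintro _ ⟨s, hs, rfl⟩
    exact hs.2
  · intro s hs t ht hst
    have h : (Set.range s) = Set.range t := by
      have := congrArg (fun A : Finset V => (A : Set V)) hst
      simpa using this
    exact (hs.1.range_inj ht.1).1 h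

/-- The homology of a finite complex is finite-dimensional. -/
theorem finiteDimensional_homology {K : PreAbstractSimplicialComplex V} (hK : K.faces.Finite)
    (n : ℕ) : Module.Finite 𝔽 (Homology 𝔽 K n) := by
  have h1 : Module.Finite 𝔽 (chains 𝔽 K n) := 
    FiniteDimensional.span_of_finite 𝔽 ((finite_simplices hK n).image _)
  have h2 : cycles 𝔽 K n ≤ chains 𝔽 K n := by
    cases n with
    | zero => exact le_rfl
    | succ n => exact inf_le_left
  have h3 : Module.Finite 𝔽 (cycles 𝔽 K n) := Submodule.finiteDimensional_of_le h2
  infer_instance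

/-- The `P`-module `M_𝓕` induced by a simplicial filtration `𝓕 : P → sub(K)` through the homology
functor in degree `n` with coefficients in `𝔽`. -/
def homologyModule {P : Type} [PartialOrder P] {K : PreAbstractSimplicialComplex V}
    (𝓕 : P →o Set.Iic K) (n : ℕ) : P ⥤ ModuleCat.{u} 𝔽 where
  obj p := ModuleCat.of 𝔽 (Homology 𝔽 (𝓕 p).1 n)
  map f := ModuleCat.ofHom (homologyMap 𝔽 (𝓕.monotone (leOfHom f)) n)
  map_id p := by
    refine ModuleCat.hom_ext (LinearMap.ext fun x => ?_)
    obtain ⟨x, rfl⟩ := Submodule.Quotient.mk_surjective _ x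
    rfl
  map_comp f g := by
    refine ModuleCat.hom_ext (LinearMap.ext fun x => ?_)
    obtain ⟨x, rfl⟩ := Submodule.Quotient.mk_surjective _ x
    rfl

/-- `M_𝓕` takes values in finite-dimensional vector spaces when `K` is finite. -/
theorem finiteDimensional_homologyModule {P : Type} [PartialOrder P]
    {K : PreAbstractSimplicialComplex V} (hK : K.faces.Finite) (𝓕 : P →o Set.Iic K) (n : ℕ)
    (p : P) : Module.Finite 𝔽 ((homologyModule 𝔽 𝓕 n).obj p) :=
  finiteDimensional_homology 𝔽 (hK.subset (𝓕 p).2) n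

end Homology

end PersMod

end

namespace PersMod

noncomputable section Barcodes

variable {𝔽 : Type u} [Field 𝔽] {P : Type} [PartialOrder P]

/-! ### Structure maps of direct sums -/

/-- The inclusion of a summand into a direct sum of `P`-modules. -/
def directSumι {J : Type u} [DecidableEq J] (N : J → P ⥤ ModuleCat.{u} 𝔽) (j : J) :
    N j ⟶ directSum N where
  app p := ModuleCat.ofHom (DFinsupp.lsingle (M := fun j => (N j).obj p) j)
  naturality p q f := by
    refine ModuleCat.hom_ext (LinearMap.ext fun x => ?_)
    exact (DFinsupp.mapRange_single (hf := fun j => map_zero ((N j).map f).hom)).symm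

/-- The projection of a direct sum of `P`-modules onto a summand. -/
def directSumπ {J : Type u} (N : J → P ⥤ ModuleCat.{u} 𝔽) (j : J) : directSum N ⟶ N j where
  app p := ModuleCat.ofHom (DFinsupp.lapply (M := fun j => (N j).obj p) j)
  naturality p q f := by
    refine ModuleCat.hom_ext (LinearMap.ext fun x => ?_)
    rfl

/-- The map of direct sums induced by a map of index sets. -/
def directSumMap {J : Type u} [DecidableEq J] {K : Type} [DecidableEq K]
    (N : J → P ⥤ ModuleCat.{u} 𝔽) (σ : K → J) :
    directSum (fun k => N (σ k)) ⟶ directSum N where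
  app p := ModuleCat.ofHom (DFinsupp.lsum ℕ (M := fun k => (N (σ k)).obj p) fun k =>
    DFinsupp.lsingle (R := 𝔽) (M := fun j => (N j).obj p) (σ k))
  naturality p q f := by
    refine ModuleCat.hom_ext (DFinsupp.lhom_ext fun k x => ?_)
    let φ (p : P) : ∀ k : K, (N (σ k)).obj p →ₗ[𝔽] Π₀ j, (N j).obj p := fun k =>
      DFinsupp.lsingle (R := 𝔽) (M := fun j => (N j).obj p) (σ k)
    have h1 : DFinsupp.mapRange (fun k => ((N (σ k)).map f).hom)
        (fun k => map_zero ((N (σ k)).map f).hom) (DFinsupp.single k x) =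
        DFinsupp.single k (((N (σ k)).map f).hom x) := DFinsupp.mapRange_single
    have h2 : DFinsupp.mapRange (fun j => ((N j).map f).hom)
        (fun j => map_zero ((N j).map f).hom) (DFinsupp.single (σ k) x) =
        DFinsupp.single (σ k) (((N (σ k)).map f).hom x) := DFinsupp.mapRange_single
    refine (congrArg (DFinsupp.lsum ℕ (φ q)) h1).trans ?_
    refine (DFinsupp.lsum_single ℕ (φ q) k _).trans ?_
    refine h2.symm.trans ?_
    exact congrArg (DFinsupp.mapRange (fun j => ((N j).map f).hom)
        (fun j => map_zero ((N j).map f).hom)) (DFinsupp.lsum_single ℕ (φ p) k x).symm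

/-- The restriction of a direct sum of `P`-modules along an injective map of index sets. -/
def directSumComap {J : Type u} {K : Type} (N : J → P ⥤ ModuleCat.{u} 𝔽) (σ : K → J)
    (hσ : Function.Injective σ) :
    directSum N ⟶ directSum (fun k => N (σ k)) where
  app p := ModuleCat.ofHom
    { toFun := fun x => DFinsupp.comapDomain (β := fun j => (N j).obj p) σ hσ x
      map_add' := fun x y => DFinsupp.comapDomain_add σ hσ x y
      map_smul' := fun r x => DFinsupp.comapDomain_smul σ hσ r x }
  naturality p q f := by
    refine ModuleCat.hom_ext (LinearMap.ext fun x => DFinsupp.ext fun k => ?_)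
    rfl

theorem directSumMap_comap {J : Type u} [DecidableEq J] {K : Type} [DecidableEq K]
    (N : J → P ⥤ ModuleCat.{u} 𝔽) (σ : K → J) (hσ : Function.Injective σ) :
    directSumMap N σ ≫ directSumComap N σ hσ = 𝟙 _ := by
  ext p : 2
  refine ModuleCat.hom_ext (DFinsupp.lhom_ext fun k x => ?_)
  refine (congrArg (DFinsupp.comapDomain (β := fun j => (N j).obj p) σ hσ)
    (DFinsupp.lsum_single ℕ (M := fun k => (N (σ k)).obj p) (fun k =>
      DFinsupp.lsingle (R := 𝔽) (M := fun j => (N j).obj p) (σ k)) k x)).trans ?_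
  exact DFinsupp.comapDomain_single (β := fun j => (N j).obj p) σ hσ k x

/-! ### Split submodules -/

/-- The image of a map of `P`-modules. -/
def Sub.range {M N : P ⥤ ModuleCat.{u} 𝔽} (f : N ⟶ M) : Sub M where
  space p := LinearMap.range (f.app p).hom
  map_mem := by
    rintro p q h _ ⟨y, rfl⟩
    exact ⟨(N.map h).hom y, LinearMap.congr_fun (congrArg ModuleCat.Hom.hom (f.naturality h)) y⟩

/-- The kernel of a map of `P`-modules. -/
def Sub.ker {M N : P ⥤ ModuleCat.{u} 𝔽} (g : M ⟶ N) : Sub M where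
  space p := LinearMap.ker (g.app p).hom
  map_mem := by
    intro p q h x hx
    have := LinearMap.congr_fun (congrArg ModuleCat.Hom.hom (g.naturality h)) x
    rw [LinearMap.mem_ker] at hx ⊢
    refine this.trans ?_
    change (N.map h).hom ((g.app p).hom x) = 0
    rw [hx, map_zero]

theorem hom_app_of_comp_eq_id {M N : P ⥤ ModuleCat.{u} 𝔽} {f : N ⟶ M} {g : M ⟶ N}
    (h : f ≫ g = 𝟙 N) (p : P) (y : N.obj p) : (g.app p).hom ((f.app p).hom y) = y :=
  LinearMap.congr_fun (congrArg ModuleCat.Hom.hom (NatTrans.congr_app h p)) y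

theorem Sub.range_isSummand {M N : P ⥤ ModuleCat.{u} 𝔽} (f : N ⟶ M) (g : M ⟶ N)
    (h : f ≫ g = 𝟙 N) : (Sub.range f).IsSummand := by
  refine ⟨Sub.ker g, fun p => ?_⟩
  have hgf := hom_app_of_comp_eq_id h p
  refine IsCompl.of_eq (le_bot_iff.1 ?_) (top_le_iff.1 fun x _ => ?_)
  · rintro _ ⟨⟨y, rfl⟩, hy⟩
    have hy0 : y = 0 := (hgf y).symm.trans hy
    rw [hy0, map_zero]
    exact Submodule.zero_mem _
  · refine Submodule.mem_sup.2 ⟨(f.app p).hom ((g.app p).hom x), ⟨_, rfl⟩,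
      x - (f.app p).hom ((g.app p).hom x), ?_, add_sub_cancel _ _⟩
    change (g.app p).hom (x - (f.app p).hom ((g.app p).hom x)) = 0
    rw [map_sub, hgf, sub_self]

/-- A split monomorphism is an isomorphism onto its image. -/
theorem Sub.range_iso {M N : P ⥤ ModuleCat.{u} 𝔽} (f : N ⟶ M) (g : M ⟶ N)
    (h : f ≫ g = 𝟙 N) : Nonempty ((Sub.range f).toModule ≅ N) := by
  refine ⟨(NatIso.ofComponents (fun p => (LinearEquiv.ofInjective (f.app p).hom
    (Function.LeftInverse.injective (hom_app_of_comp_eq_id h p))).toModuleIso) ?_).symm⟩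
  intro p q k
  refine ModuleCat.hom_ext (LinearMap.ext fun x => Subtype.ext ?_)
  exact LinearMap.congr_fun (congrArg ModuleCat.Hom.hom (f.naturality k)) x

/-! ### The generalized rank of an interval decomposable module -/

variable {M : P ⥤ ModuleCat.{u} 𝔽} {J : Type u} {B : J → PosetInterval P}

theorem mem_intervalSpace {I : PosetInterval P} {p : P} (hp : p ∈ I.carrier) (a : 𝔽) :
    a ∈ intervalSpace 𝔽 I p := by
  rw [intervalSpace, if_pos hp]; trivial

/-- The unit vector of the interval module at a point of the interval. -/
def intervalOne (𝔽 : Type u) [Field 𝔽] {I : PosetInterval P} {p : P} (hp : p ∈ I.carrier) :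
    (intervalModule 𝔽 I).obj p :=
  (⟨1, mem_intervalSpace hp 1⟩ : intervalSpace 𝔽 I p)

theorem map_intervalOne {I : PosetInterval P} {p q : P} (f : p ⟶ q) (hp : p ∈ I.carrier)
    (hq : q ∈ I.carrier) :
    ((intervalModule 𝔽 I).map f).hom (intervalOne 𝔽 hp) = intervalOne 𝔽 hq :=
  Subtype.ext (intervalMap_apply_of_mem I hp hq _)

theorem nat_apply {M N : P ⥤ ModuleCat.{u} 𝔽} (f : M ⟶ N) {p q : P} (h : p ⟶ q)
    (x : M.obj p) : (f.app q).hom ((M.map h).hom x) = (N.map h).hom ((f.app p).hom x) :=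
  LinearMap.congr_fun (congrArg ModuleCat.Hom.hom (f.naturality h)) x

/-- A map from an interval module gives a section over every subinterval. -/
def sectionOfHom {L I : PosetInterval P} (f : intervalModule 𝔽 L ⟶ M)
    (hIL : I.carrier ⊆ L.carrier) : Cone (restrict M I) where
  pt := ModuleCat.of 𝔽 𝔽
  π :=
    { app := fun p => ModuleCat.ofHom
        (LinearMap.toSpanSingleton 𝔽 _ ((f.app p.1).hom (intervalOne 𝔽 (hIL p.2))))
      naturality := by
        intro p q h
        refine ModuleCat.hom_ext (LinearMap.ext_ring ?_)
        let k := (Subtype.mono_coe (· ∈ I.carrier)).functor.map h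
        have h' := nat_apply f k (intervalOne 𝔽 (hIL p.2))
        rw [map_intervalOne k _ (hIL q.2)] at h'
        exact ((one_smul 𝔽 _).trans h').trans
          (congrArg (M.map k).hom (one_smul 𝔽 _).symm) }

/-- A map to an interval module gives a functional on the colimit over every subinterval. -/
def functionalOfHom {L I : PosetInterval P} (g : M ⟶ intervalModule 𝔽 L)
    (hIL : I.carrier ⊆ L.carrier) : Cocone (restrict M I) where
  pt := ModuleCat.of 𝔽 𝔽
  ι :=
    { app := fun p => ModuleCat.ofHom ((intervalSpace 𝔽 L p.1).subtype ∘ₗ (g.app p.1).hom)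
      naturality := by
        intro p q h
        refine ModuleCat.hom_ext (LinearMap.ext fun x => ?_)
        have h' := nat_apply g ((Subtype.mono_coe (· ∈ I.carrier)).functor.map h) x
        exact (congrArg Subtype.val h').trans
          (intervalMap_apply_of_mem L (hIL p.2) (hIL q.2) _) }

theorem limitToColimit_apply (I : PosetInterval P) (p : I.carrier)
    (x : (limit (restrict M I) : ModuleCat.{u} 𝔽)) :
    (limitToColimit M I).hom x =
      (colimit.ι (restrict M I) p).hom ((limit.π (restrict M I) p).hom x) := by
  unfold limitToColimit
  rw [limitToColimitAt_eq M I _ p]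
  rfl

theorem limitToColimit_endomorphism (I : PosetInterval P) (f : M ⟶ M) (p q : I.carrier)
    (x : (limit (restrict M I) : ModuleCat.{u} 𝔽)) :
    (colimit.ι (restrict M I) p).hom ((f.app p.1).hom ((limit.π (restrict M I) p).hom x)) =
    (colimit.ι (restrict M I) q).hom ((f.app q.1).hom ((limit.π (restrict M I) q).hom x)) := by
  let F : restrict M I ⟶ restrict M I :=
    Functor.whiskerLeft (Subtype.mono_coe (· ∈ I.carrier)).functor f
  have key : ∀ r : I.carrier, (limit.π (restrict M I) r).hom ((limMap F).hom x) =
      (f.app r.1).hom ((limit.π (restrict M I) r).hom x) := fun r =>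
    LinearMap.congr_fun (congrArg ModuleCat.Hom.hom (limMap_π F r)) x
  rw [← key p, ← key q, ← limitToColimit_apply, ← limitToColimit_apply]

/-- The generalized rank of an interval decomposable module over `I` counts the bars
containing `I`. -/
theorem IsBarcode.rk_eq_encard (hB : IsBarcode M B) (hfin : ∀ p, Module.Finite 𝔽 (M.obj p))
    (I : PosetInterval P) :
    {j | I.carrier ⊆ (B j).carrier}.encard = (rk M I : ℕ∞) := by
  classical
  obtain ⟨e⟩ := hB
  let N : J → P ⥤ ModuleCat.{u} 𝔽 := fun j => intervalModule 𝔽 (B j)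
  let i : ∀ j, N j ⟶ M := fun j => directSumι N j ≫ e.inv
  let r : ∀ j, M ⟶ N j := fun j => e.hom ≫ directSumπ N j
  let S : Set J := {j | I.carrier ⊆ (B j).carrier}
  let p : I.carrier := ⟨I.nonempty.some, I.nonempty.some_mem⟩
  have hr : ∀ (q : P) (j k : J) (y : (N j).obj q), ((r k).app q).hom (((i j).app q).hom y) =
      (DFinsupp.single j y : Π₀ j, (N j).obj q) k := by
    intro q j k y
    exact congrArg (fun z : Π₀ j, (N j).obj q => z k)
      (hom_app_of_comp_eq_id e.inv_hom_id q (DFinsupp.single j y))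
  have hsum : ∀ (x : M.obj p.1), ∃ T : Finset J,
      x = ∑ j ∈ T, ((i j).app p.1).hom (((r j).app p.1).hom x) := by
    intro x
    let y : Π₀ j, (N j).obj p.1 := (e.hom.app p.1).hom x
    refine ⟨y.support, ?_⟩
    have hx : (e.inv.app p.1).hom y = x := hom_app_of_comp_eq_id e.hom_inv_id p.1 x
    have hy : ∑ j ∈ y.support, DFinsupp.single j (y j) = y := DFinsupp.sum_single
    refine hx.symm.trans ((congrArg (e.inv.app p.1).hom hy.symm).trans ?_)
    exact map_sum (e.inv.app p.1).hom _ _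
  let w : S → M.obj p.1 := fun j => ((i j.1).app p.1).hom (intervalOne 𝔽 (j.2 p.2))
  let v : S → (colimit (restrict M I) : ModuleCat.{u} 𝔽) := fun j =>
    (colimit.ι (restrict M I) p).hom (w j)
  let τ : ∀ k : S, (colimit (restrict M I) : ModuleCat.{u} 𝔽) →ₗ[𝔽] 𝔽 := fun k =>
    (colimit.desc (restrict M I) (functionalOfHom (r k.1) k.2)).hom
  have hτ : ∀ j k : S, τ k (v j) = if j = k then 1 else 0 := by
    intro j k
    have h1 : τ k (v j) = (((r k.1).app p.1).hom (w j) : intervalSpace 𝔽 (B k.1) p.1).1 :=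
      LinearMap.congr_fun (congrArg ModuleCat.Hom.hom
        (colimit.ι_desc (functionalOfHom (r k.1) k.2) p)) (w j)
    rw [h1]
    simp only [w]
    rw [hr]
    split_ifs with h
    · subst h
      rw [DFinsupp.single_eq_same]
      rfl
    · rw [DFinsupp.single_eq_of_ne (fun h' => h (Subtype.ext h'.symm))]
      rfl
  have hv : LinearIndependent 𝔽 v := by
    rw [linearIndependent_iff']
    intro s c hc k hk
    have := congrArg (τ k) hc
    simpa [map_sum, hτ, hk] using this
  have hw : LinearIndependent 𝔽 w :=
    LinearIndependent.of_comp (colimit.ι (restrict M I) p).hom hv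
  have := hfin p.1
  have hS : Finite S := hw.finite
  have : Fintype S := Fintype.ofFinite S
  have hrange : LinearMap.range (limitToColimit M I).hom = Submodule.span 𝔽 (Set.range v) := by
    apply le_antisymm
    · rintro _ ⟨x, rfl⟩
      rw [limitToColimit_apply I p]
      obtain ⟨T, hT⟩ := hsum ((limit.π (restrict M I) p).hom x)
      have hT' := (congrArg (colimit.ι (restrict M I) p).hom hT).trans
        (map_sum (colimit.ι (restrict M I) p).hom _ _)
      rw [hT']
      refine Submodule.sum_mem _ fun j _ => ?_
      by_cases hj : j ∈ S
      · let a : intervalSpace 𝔽 (B j) p.1 :=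
          ((r j).app p.1).hom ((limit.π (restrict M I) p).hom x)
        have ha : a = a.1 • (intervalOne 𝔽 (hj p.2) : intervalSpace 𝔽 (B j) p.1) :=
          Subtype.ext (mul_one _).symm
        have : (colimit.ι (restrict M I) p).hom (((i j).app p.1).hom a) = a.1 • v ⟨j, hj⟩ := by
          refine (congrArg (fun b => (colimit.ι (restrict M I) p).hom
            (((i j).app p.1).hom b)) ha).trans ?_
          exact (congrArg (colimit.ι (restrict M I) p).hom
            (map_smul ((i j).app p.1).hom a.1 _)).trans
            (map_smul (colimit.ι (restrict M I) p).hom a.1 _)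
        exact this ▸ Submodule.smul_mem _ _ (Submodule.subset_span ⟨_, rfl⟩)
      · obtain ⟨q, hqI, hq⟩ := Set.not_subset.1 hj
        have h := limitToColimit_endomorphism I (r j ≫ i j) p ⟨q, hqI⟩ x
        have h0 : (((r j ≫ i j).app q).hom ((limit.π (restrict M I) ⟨q, hqI⟩).hom x)) = 0 := by
          change ((i j).app q).hom (((r j).app q).hom _) = 0
          rw [show ((r j).app q).hom ((limit.π (restrict M I) ⟨q, hqI⟩).hom x) = 0 from
            intervalSpace_eq_zero (B j) hq _, map_zero]
        have h1 : (colimit.ι (restrict M I) p).hom (((r j ≫ i j).app p.1).hom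
            ((limit.π (restrict M I) p).hom x)) = 0 :=
          h.trans ((congrArg (colimit.ι (restrict M I) ⟨q, hqI⟩).hom h0).trans (map_zero _))
        have h2 : (colimit.ι (restrict M I) p).hom (((i j).app p.1).hom (((r j).app p.1).hom
            ((limit.π (restrict M I) p).hom x))) = 0 := h1
        exact h2 ▸ Submodule.zero_mem _
    · rw [Submodule.span_le]
      rintro _ ⟨j, rfl⟩
      refine ⟨(limit.lift (restrict M I) (sectionOfHom (i j.1) j.2)).hom (1 : 𝔽), ?_⟩
      rw [limitToColimit_apply I p]
      have h := LinearMap.congr_fun (congrArg ModuleCat.Hom.hom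
        (limit.lift_π (sectionOfHom (i j.1) j.2) p)) (1 : 𝔽)
      exact congrArg (colimit.ι (restrict M I) p).hom (h.trans (one_smul 𝔽 (w j)))
  rw [rk, hrange, finrank_span_eq_card hv, ← Nat.card_eq_fintype_card, Nat.card_coe_set_eq]
  exact (Set.Finite.cast_ncard_eq (s := S) hS).symm

/-- A bar containing a maximal interval of positive rank equals it. -/
theorem IsBarcode.eq_of_subset (hB : IsBarcode M B) (hfin : ∀ p, Module.Finite 𝔽 (M.obj p))
    (hbars : ∀ j, B j ∈ finiteIntervals P) {I : PosetInterval P}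
    (hI : IsMaximalInterval M I) {j : J} (hj : I.carrier ⊆ (B j).carrier) : B j = I := by
  by_contra hne
  refine hI.2 ⟨B j, hbars j, hj.ssubset_of_ne fun h => hne (PosetInterval.ext h.symm),
    fun h0 => ?_⟩
  have h := hB.rk_eq_encard hfin (B j)
  rw [h0, Nat.cast_zero, Set.encard_eq_zero] at h
  exact (Set.eq_empty_iff_forall_notMem.1 h j) (subset_refl (B j).carrier)

theorem IsBarcode.multiplicity_eq_rk (hB : IsBarcode M B)
    (hfin : ∀ p, Module.Finite 𝔽 (M.obj p)) (hbars : ∀ j, B j ∈ finiteIntervals P)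
    {I : PosetInterval P} (hI : IsMaximalInterval M I) :
    multiplicity B I = (rk M I : ℕ∞) := by
  rw [← hB.rk_eq_encard hfin I, multiplicity]
  congr 1
  ext j
  exact ⟨fun h => (congrArg PosetInterval.carrier h).ge,
    fun h => hB.eq_of_subset hfin hbars hI h⟩

/-- The bars equal to `I` span a summand isomorphic to a power of the interval module. -/
theorem IsBarcode.exists_summand (hB : IsBarcode M B) {I : PosetInterval P} {m : ℕ}
    (hm : multiplicity B I = m) :
    ∃ N : Sub M, N.IsSummand ∧
      Nonempty (N.toModule ≅ directSum fun _ : Fin m => intervalModule 𝔽 I) := by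
  classical
  obtain ⟨e⟩ := hB
  have hfin : {j | B j = I}.Finite := Set.finite_of_encard_eq_coe hm
  have : Finite {j | B j = I} := hfin
  have hcard : Nat.card {j | B j = I} = m := by
    rw [Nat.card_coe_set_eq, Set.ncard, ← multiplicity, hm, ENat.toNat_natCast]
  let E : Fin m ≃ {j | B j = I} := (Finite.equivFinOfCardEq hcard).symm
  let σ : Fin m → J := fun k => (E k).1
  have hσ : Function.Injective σ := Subtype.val_injective.comp E.injective
  let N : J → P ⥤ ModuleCat.{u} 𝔽 := fun j => intervalModule 𝔽 (B j)
  have hN : (fun k => N (σ k)) = fun _ => intervalModule 𝔽 I :=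
    funext fun k => congrArg (intervalModule 𝔽) (E k).2
  have h : (directSumMap N σ ≫ e.inv) ≫ (e.hom ≫ directSumComap N σ hσ) = 𝟙 _ := by
    rw [Category.assoc, e.inv_hom_id_assoc, directSumMap_comap]
  rw [← hN]
  exact ⟨_, Sub.range_isSummand _ _ h, Sub.range_iso _ _ h⟩

end Barcodes

end PersMod

theorem mainTheorem6 {𝔽 : Type u} [Field 𝔽] {V : Type u} [LinearOrder V]
    (K : PreAbstractSimplicialComplex V) (hK : K.faces.Finite)
    (P : PersMod.PosetInterval (ℤ × ℤ)) (hP : P ∈ PersMod.finiteIntervals (ℤ × ℤ))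
    (𝓕 : P.carrier →o Set.Iic K) (n : ℕ)
    (hM : PersMod.IntervalDecomposable (PersMod.homologyModule 𝔽 𝓕 n))
    (I : PersMod.PosetInterval P.carrier)
    (hI : PersMod.IsMaximalInterval (PersMod.homologyModule 𝔽 𝓕 n) I) :
    (∀ (J : Type u) (B : J → PersMod.PosetInterval P.carrier),
      PersMod.IsBarcode (PersMod.homologyModule 𝔽 𝓕 n) B →
        I ∈ Set.range B ∧
        PersMod.multiplicity B I = (PersMod.rk (PersMod.homologyModule 𝔽 𝓕 n) I : ℕ∞)) ∧
    ∃ N : PersMod.Sub (PersMod.homologyModule 𝔽 𝓕 n), N.IsSummand ∧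
      Nonempty (N.toModule ≅ PersMod.directSum
        fun _ : Fin (PersMod.rk (PersMod.homologyModule 𝔽 𝓕 n) I) =>
          PersMod.intervalModule 𝔽 I) := by
  have hfin := PersMod.finiteDimensional_homologyModule 𝔽 hK 𝓕 n
  have : Finite P.carrier := hP
  have hint : ∀ L : PersMod.PosetInterval P.carrier,
      L ∈ PersMod.finiteIntervals P.carrier := fun L => L.carrier.toFinite
  refine ⟨fun J B hB => ?_, ?_⟩
  · have hm := hB.multiplicity_eq_rk hfin (fun j => hint (B j)) hI
    refine ⟨?_, hm⟩
    have hne : PersMod.multiplicity B I ≠ 0 := by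
      rw [hm]
      exact_mod_cast hI.1.2.ne'
    obtain ⟨j, hj⟩ := Set.encard_ne_zero.1 hne
    exact ⟨j, hj⟩
  · obtain ⟨J, B, hB⟩ := hM
    exact hB.exists_summand (hB.multiplicity_eq_rk hfin (fun j => hint (B j)) hI)
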